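/- Let $N, K, v$ be positive integers and $\beta$ a nonnegative integer with $\beta < K$, and let $\mathbb{F}$ be a finite field. In an $(N,K,\beta,v)$ distributed encoding system each of $K$ source nodes sends a symbol $x_{n,k}\in\mathbb{F}$ ($k\in[K]$) to each of $N$ encoding nodes ($n\in[N]$). A set $\mathcal{A}\subseteq[K]$ of at most $\beta$ sources, unknown to the decoder, is adversarial. Every honest source $k\in\mathcal{H}=[K]\setminus\mathcal{A}$ has a message $x_k$ and sends $x_{n,k}=x_k$ to all $n\in[N]$; every source $k\in\mathcal{A}$ may send arbitrary symbols with $|\{x_{1,k},\dots,x_{N,k}\}|\le v$. Encoding node $n$ stores $y_n=f_n(x_{n,1},\dots,x_{n,K})$, where $f_n:\mathbb{F}^K\to\mathbb{F}$. A code consists of encoding functions $f_1,\dots,f_N$ and, for each $\mathcal{T}\subseteq[N]$ with $|\mathcal{T}|=t$, an arbitrary decoding function $g_{\mathcal{T}}:\mathbb{F}^t\to\mathbb{F}^K$. It is called $t$-correct if 1. for every $\mathcal{T}$ with $|\mathcal{T}|=t$, every $\mathcal{A}$ and every behaviour of the sources as above, the output $(\hat x_1,\dots,\hat x_K)=g_{\mathcal{T}}((y_n)_{n\in\mathcal{T}})$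 satisfies $\hat x_k=x_k$ for all $k\in\mathcal{H}$; and 2. (MDS) when all sources are honest, all $K$ messages can be recovered from the values stored in any $K$ encoding nodes. Let $t^*_{\mathrm{linear}}(N,K,\beta,v)$ be the minimum $t$ for which there is a $t$-correct code over $\mathbb{F}$ whose encoding functions $f_1,\dots,f_N$ are all linear. **Theorem.** There is a $q_0$ depending only on $N,K,\beta,v$ such that, for every finite field $\mathbb{F}$ with $|\mathbb{F}|\ge q_0$, this minimum exists whenever $N\ge K$, and $$t^*_{\mathrm{linear}}(N,K,\beta,v)=\begin{cases}K+2\beta(v-1) & \text{if } N\ge K+2\beta(v-1),\\ N & \text{if } K\le N<K+2\beta(v-1).\end{cases}$$ -/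

import Mathlib

namespace DistEnc

/-- A code for `K` source nodes and `N` encoding nodes over the alphabet `F`, with a decoder that
contacts `t` encoding nodes: `enc n` is the encoding function of node `n`, and `dec T hT` is the
decoding function for the set `T` of contacted nodes, which sees exactly the symbols stored in `T`
(it is told neither who is adversarial nor how the adversary acts). -/
structure Code (F : Type*) (N K t : ℕ) where
  enc : Fin N → (Fin K → F) → F
  dec : (T : Finset (Fin N)) → T.card = t → (T → F) → (Fin K → F)

/-- A possible behaviour of the source nodes, where `x n k` is the symbol that source `k` sends to
encoding node `n`: the set `A` of adversarial sources has at most `β` elements, every source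
outside `A` sends its message `m k` to all encoding nodes, and every source in `A` sends at most
`v` distinct symbols in total. (The values `m k` with `k ∈ A` play no role.) -/
structure IsBehaviour {F : Type*} {N K : ℕ} (β v : ℕ)
    (A : Finset (Fin K)) (m : Fin K → F) (x : Fin N → Fin K → F) : Prop where
  card_le : A.card ≤ β
  honest : ∀ k, k ∉ A → ∀ n, x n k = m k
  versions : ∀ k, k ∈ A → (Set.range fun n => x n k).ncard ≤ v

namespace Code

variable {F : Type*} {N K t : ℕ}

/-- Whatever `t` encoding nodes are contacted and however the sources behave, the decoder outputs
the true message of every honest source. -/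
def RecoversHonest (C : Code F N K t) (β v : ℕ) : Prop :=
  ∀ (T : Finset (Fin N)) (hT : T.card = t)
    (A : Finset (Fin K)) (m : Fin K → F) (x : Fin N → Fin K → F),
    IsBehaviour β v A m x →
      ∀ k, k ∉ A → C.dec T hT (fun n => C.enc n (x n)) k = m k

/-- The encoding is maximum distance separable: if all sources are honest, then all `K` messages
can be recovered from any `K` encoding nodes. -/
def IsMDS (C : Code F N K t) : Prop :=
  ∀ S : Finset (Fin N), S.card = K →
    ∃ r : (S → F) → (Fin K → F), ∀ m : Fin K → F, r (fun n => C.enc n m) = m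

/-- `t`-correctness of a code for the `(N, K, β, v)` distributed encoding system. -/
def IsCorrect (C : Code F N K t) (β v : ℕ) : Prop :=
  C.RecoversHonest β v ∧ C.IsMDS

/-- All encoding functions are linear (nothing is required of the decoding functions). -/
def IsLinear [Field F] (C : Code F N K t) : Prop :=
  ∀ n, IsLinearMap F (C.enc n)

end Code

/-- The set of all `t` for which a `t`-correct code with linear encoding functions over `F` exists.
Its minimum is `t*_linear(N, K, β, v)`. -/
def linearCorrectSet (F : Type*) [Field F] (N K β v : ℕ) : Set ℕ :=
  {t | ∃ C : Code F N K t, C.IsLinear ∧ C.IsCorrect β v}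

end DistEnc

/-! A linear code is an `N × K` matrix. Relative to one reference value per source, a behaviour is a
vector plus deviations with at most `β(v-1)` parameters, placed in a pattern that does not involve
the field. Two behaviours that look alike on `T` differ by an array row-wise orthogonal to the
matrix on `T`. If they disagree about a source `k` honest in both, column `k` of that array is a
nonzero constant, which scales to `1`. For fixed patterns at most `q^(K-1+2β(v-1))` such arrays
exist, each orthogonal on `T` to a fraction `q^(-#T)` of all matrices. For `#T = K+2β(v-1)` and
large `q`, a union bound leaves a good matrix (`exists_trivialKernels_separatesErrors`). When all
`N` nodes are read, a systematic MDS code suffices.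

Conversely (`notMem_linearCorrectSet`), MDS provides messages `d`, nonzero at an honest source, that
encode to zero on `K-1` of `K` given nodes. Two behaviours, with messages `d` and `0`, can alter
`2β(v-1)` single entries between them, and each alteration hides `d` at one further node. Hence no
`t < N` below `K+2β(v-1)` works. -/

namespace DistEnc

/-! ### Counting matrices -/

/-- If every member of a family `z` of matrices has entries `1` in column `k` on the rows `T`, and
the family is small compared with `q ^ #T`, then few matrices `C` are row-wise orthogonal on `T` to
some member of the family. -/
theorem card_orthogonal_le {F ι κ Θ : Type*} [Field F] [Fintype F] [Fintype ι] [DecidableEq ι]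
    [Fintype κ] [DecidableEq κ] [Fintype Θ] (T : Finset ι) (k : κ) (z : Θ → ι → κ → F)
    (hz : ∀ θ n, z θ n k = 1)
    (hΘ : Fintype.card Θ * Fintype.card F ≤ Fintype.card F ^ T.card) :
    Nat.card {C : ι → κ → F | ∃ θ, ∀ n ∈ T, ∑ l, C n l * z θ n l = 0} * Fintype.card F
      ≤ Fintype.card (ι → κ → F) := by
  classical
  set B := {C : ι → κ → F | ∃ θ, ∀ n ∈ T, ∑ l, C n l * z θ n l = 0}
  choose θ hθ using fun C : B => C.2
  -- Shift column `k` of a bad matrix by a free vector on `T`. As `z` is `1` there, the products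
  -- with `z` reveal the shift, so `Φ` is injective.
  let Φ : B × (T → F) → (ι → κ → F) × Θ := fun p =>
    (fun n l => p.1.1 n l + (if h : n ∈ T then (if l = k then p.2 ⟨n, h⟩ else 0) else 0), θ p.1)
  have hsum (p : B × (T → F)) (n : ι) (hn : n ∈ T) :
      ∑ l, (Φ p).1 n l * z (Φ p).2 n l = p.2 ⟨n, hn⟩ := by
    simp only [Φ, hn, dif_pos, add_mul, Finset.sum_add_distrib, hθ p.1 n hn, zero_add, ite_mul,
      zero_mul, Finset.sum_ite_eq', Finset.mem_univ, if_true, hz, mul_one]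
  have hΦ : Function.Injective Φ := by
    intro p p' h
    have h2 : p.2 = p'.2 := by
      funext n
      rw [← hsum p n n.2, ← hsum p' n n.2, h]
    refine Prod.ext (Subtype.ext ?_) h2
    funext n l
    have h1 := congrFun (congrFun (congrArg Prod.fst h) n) l
    simp only [Φ, h2] at h1
    exact add_right_cancel h1
  have hcard := Nat.card_le_card_of_injective Φ hΦ
  rw [Nat.card_prod, Nat.card_prod, Nat.card_fun, Nat.card_eq_fintype_card (α := Θ),
    Nat.card_eq_fintype_card (α := ι → κ → F), Nat.card_eq_fintype_card (α := F),
    Nat.card_eq_fintype_card (α := T), Fintype.card_coe] at hcard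
  have hpos : 0 < Fintype.card F ^ T.card := pow_pos Fintype.card_pos _
  refine Nat.le_of_mul_le_mul_right ?_ hpos
  calc Nat.card B * Fintype.card F * Fintype.card F ^ T.card
      = (Nat.card B * Fintype.card F ^ T.card) * Fintype.card F := by ring
    _ ≤ (Fintype.card (ι → κ → F) * Fintype.card Θ) * Fintype.card F :=
        Nat.mul_le_mul_right _ hcard
    _ = Fintype.card (ι → κ → F) * (Fintype.card Θ * Fintype.card F) := by ring
    _ ≤ _ := Nat.mul_le_mul_left _ hΘ

/-- Union bound: fewer than `q` sets, each of density at most `1/q`, cannot cover `X`. -/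
theorem exists_forall_notMem_of_card_mul_le {X ι : Type*} [Fintype X] [Nonempty X] [Fintype ι]
    (B : ι → Set X) (q : ℕ) (hB : ∀ i, Nat.card (B i) * q ≤ Fintype.card X)
    (hq : Fintype.card ι < q) : ∃ x, ∀ i, x ∉ B i := by
  classical
  by_contra! h
  have hcover : (Finset.univ : Finset X) ⊆ Finset.univ.biUnion fun i => (B i).toFinset := by
    intro x _
    obtain ⟨i, hi⟩ := h x
    simpa using ⟨i, hi⟩
  have h1 : Fintype.card X ≤ ∑ i, Nat.card (B i) := by
    refine (Finset.card_le_card hcover).trans (Finset.card_biUnion_le.trans (le_of_eq ?_))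
    simp [Set.toFinset_card]
  have h2 : Fintype.card X * q ≤ Fintype.card ι * Fintype.card X := by
    calc Fintype.card X * q ≤ (∑ i, Nat.card (B i)) * q := Nat.mul_le_mul_right _ h1
      _ = ∑ i, Nat.card (B i) * q := Finset.sum_mul ..
      _ ≤ ∑ _i : ι, Fintype.card X := Finset.sum_le_sum fun i _ => hB i
      _ = _ := by simp
  have h3 : 0 < Fintype.card X := Fintype.card_pos
  nlinarith

/-- The error in which the value `a j` occurs at the positions that the pattern `P` labels `j`. -/
def patternError {F J : Type*} [Zero F] {N K : ℕ} (P : Fin N → Fin K → Option J) (a : J → F)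
    (n : Fin N) (l : Fin K) : F :=
  (P n l).elim 0 a

theorem patternError_smul {F J : Type*} [Field F] {N K : ℕ} (P : Fin N → Fin K → Option J)
    (c : F) (a : J → F) (n : Fin N) (l : Fin K) :
    patternError P (fun j => c * a j) n l = c * patternError P a n l := by
  unfold patternError
  cases P n l <;> simp

/-- No nonzero message is encoded to zero on `K` nodes. -/
def HasTrivialKernels {F : Type*} [Field F] {N K : ℕ} (C : Fin N → Fin K → F) : Prop :=
  ∀ T : Finset (Fin N), T.card = K → ∀ d : Fin K → F,
    (∀ n ∈ T, ∑ l, C n l * d l = 0) → d = 0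

/-- On `K + 2 * #J` nodes, a difference of two errors with `#J` values each does not disguise a
change of a message that the errors do not touch. -/
def SeparatesErrors {F : Type*} [Field F] {N K : ℕ} (J : Type*) [Fintype J]
    (C : Fin N → Fin K → F) : Prop :=
  ∀ T : Finset (Fin N), T.card = K + 2 * Fintype.card J →
    ∀ (P P' : Fin N → Fin K → Option J) (e : Fin K → F) (a a' : J → F) (k : Fin K),
      (∀ n, P n k = none) → (∀ n, P' n k = none) →
      (∀ n ∈ T, ∑ l, C n l * (e l + patternError P a n l - patternError P' a' n l) = 0) →
      e k = 0

/-- The vector with entry `1` at `k` and the given entries elsewhere. -/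
def extendOne {F : Type*} [One F] {K : ℕ} (k : Fin K) (e : {l : Fin K // l ≠ k} → F)
    (l : Fin K) : F :=
  if h : l = k then 1 else e ⟨l, h⟩

theorem extendOne_restrict {F : Type*} [One F] {K : ℕ} {k : Fin K} {e : Fin K → F}
    (he : e k = 1) : extendOne k (fun l => e l) = e := by
  funext l
  unfold extendOne
  split_ifs with h
  · rw [h, he]
  · rfl

theorem exists_trivialKernels_separatesErrors (N K : ℕ) (J : Type) [Fintype J] :
    ∃ q₀ : ℕ, ∀ (F : Type*) [Field F] [Finite F], q₀ ≤ Nat.card F →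
      ∃ C : Fin N → Fin K → F, HasTrivialKernels C ∧ SeparatesErrors J C := by
  classical
  let ι₁ := Finset (Fin N) × Fin K
  let ι₂ := Finset (Fin N) × Fin K × (Fin N → Fin K → Option J) × (Fin N → Fin K → Option J)
  -- The bad events are indexed by node sets, sources and patterns, so their number is independent
  -- of `F`.
  refine ⟨Fintype.card (ι₁ ⊕ ι₂) + 1, fun F _ _ hq => ?_⟩
  have := Fintype.ofFinite F
  rw [Nat.card_eq_fintype_card] at hq
  let B₁ : ι₁ → Set (Fin N → Fin K → F) := fun i =>
    {C | i.1.card = K ∧ ∃ θ : {l // l ≠ i.2} → F,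
      ∀ n ∈ i.1, ∑ l, C n l * extendOne i.2 θ l = 0}
  let B₂ : ι₂ → Set (Fin N → Fin K → F) := fun i =>
    {C | (i.1.card = K + 2 * Fintype.card J ∧ (∀ n, i.2.2.1 n i.2.1 = none) ∧
        ∀ n, i.2.2.2 n i.2.1 = none) ∧
      ∃ θ : ({l // l ≠ i.2.1} → F) × (J → F) × (J → F), ∀ n ∈ i.1,
        ∑ l, C n l * (extendOne i.2.1 θ.1 l + patternError i.2.2.1 θ.2.1 n l
          - patternError i.2.2.2 θ.2.2 n l) = 0}
  have hcompl (k : Fin K) : Fintype.card {l : Fin K // l ≠ k} = K - 1 := by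
    simp [Fintype.card_subtype_compl]
  obtain ⟨C, hC⟩ := exists_forall_notMem_of_card_mul_le (Sum.elim B₁ B₂) (Fintype.card F) (by
    rintro (⟨T, k⟩ | ⟨T, k, P, P'⟩)
    · by_cases hT : T.card = K
      · have hk : 0 < K := k.pos
        have hB : B₁ (T, k) = {C | ∃ θ : {l // l ≠ k} → F,
            ∀ n ∈ T, ∑ l, C n l * extendOne k θ l = 0} := by
          ext C
          simp [B₁, hT]
        rw [Sum.elim_inl, hB]
        exact card_orthogonal_le T k
          (fun (θ : {l // l ≠ k} → F) (_ : Fin N) l => extendOne k θ l)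
          (fun θ n => by simp [extendOne]) (by
            rw [Fintype.card_fun, hcompl, hT, ← pow_succ]
            exact le_of_eq (by congr 1; omega))
      · simp [B₁, hT]
    · by_cases hT : T.card = K + 2 * Fintype.card J ∧ (∀ n, P n k = none) ∧ ∀ n, P' n k = none
      · have hk : 0 < K := k.pos
        have hB : B₂ (T, k, P, P') = {C | ∃ θ : ({l // l ≠ k} → F) × (J → F) × (J → F),
            ∀ n ∈ T, ∑ l, C n l * (extendOne k θ.1 l + patternError P θ.2.1 n l
              - patternError P' θ.2.2 n l) = 0} := by
          ext C
          simp [B₂, hT]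
        rw [Sum.elim_inr, hB]
        exact card_orthogonal_le T k
          (fun (θ : ({l // l ≠ k} → F) × (J → F) × (J → F)) n l =>
            extendOne k θ.1 l + patternError P θ.2.1 n l - patternError P' θ.2.2 n l)
          (fun θ n => by simp [extendOne, patternError, hT.2.1, hT.2.2]) (by
            -- Normalising entry `k` leaves `K - 1 + 2 * #J` parameters, one fewer than the rows in
            -- `T`.
            rw [Fintype.card_prod, Fintype.card_prod, Fintype.card_fun, Fintype.card_fun, hcompl,
              hT.1, ← pow_add, ← pow_add, ← pow_succ]
            exact le_of_eq (by congr 1; omega))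
      · have : B₂ (T, k, P, P') = ∅ := by
          ext C
          exact ⟨fun h => hT h.1, fun h => h.elim⟩
        simp [this]) (by omega)
  refine ⟨C, fun T hT d hd => ?_, fun T hT P P' e a a' k hP hP' h => ?_⟩
  · by_contra hne
    obtain ⟨k, hk⟩ := Function.ne_iff.mp hne
    refine hC (Sum.inl (T, k)) ⟨hT, fun l => (d k)⁻¹ * d l, fun n hn => ?_⟩
    have hk' : d k ≠ 0 := hk
    dsimp only
    rw [extendOne_restrict (e := fun l => (d k)⁻¹ * d l) (inv_mul_cancel₀ hk')]
    simp only [mul_left_comm _ (d k)⁻¹, ← Finset.mul_sum, hd n hn, mul_zero]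
  · by_contra hk
    refine hC (Sum.inr (T, k, P, P')) ⟨⟨hT, hP, hP'⟩, ⟨fun l => (e k)⁻¹ * e l,
      fun j => (e k)⁻¹ * a j, fun j => (e k)⁻¹ * a' j⟩, fun n hn => ?_⟩
    dsimp only
    rw [extendOne_restrict (e := fun l => (e k)⁻¹ * e l) (inv_mul_cancel₀ hk)]
    simp only [patternError_smul, ← mul_add, ← mul_sub, mul_left_comm _ (e k)⁻¹,
      ← Finset.mul_sum, h n hn, mul_zero]

/-! ### Achievability -/

theorem exists_fin_range_superset {α : Type*} [Nonempty α] {s : Set α} (hs : s.Finite) {p : ℕ}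
    (hp : s.ncard ≤ p) : ∃ h : Fin p → α, s ⊆ Set.range h := by
  classical
  have := hs.fintype
  obtain ⟨f⟩ : Nonempty (s ↪ Fin p) := Function.Embedding.nonempty_of_card_le (by
    rwa [Fintype.card_fin, ← Nat.card_eq_fintype_card, Nat.card_coe_set_eq])
  refine ⟨Function.extend f Subtype.val fun _ => Classical.arbitrary α, fun x hx => ⟨f ⟨x, hx⟩, ?_⟩⟩
  rw [f.injective.extend_apply]

/-- The reference value of an adversarial source is what it sends to `n₀`, which leaves at most `v -
1` other values to label. -/
theorem IsBehaviour.exists_patternError {F : Type*} [Field F] {N K β v : ℕ}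
    {A : Finset (Fin K)} {m : Fin K → F} {x : Fin N → Fin K → F} (h : IsBehaviour β v A m x) :
    ∃ (e : Fin K → F) (P : Fin N → Fin K → Option (Fin β × Fin (v - 1)))
      (a : Fin β × Fin (v - 1) → F),
      (∀ n l, x n l = e l + patternError P a n l) ∧
        ∀ k, k ∉ A → e k = m k ∧ ∀ n, P n k = none := by
  classical
  rcases isEmpty_or_nonempty (Fin K) with hK | hK
  · exact ⟨m, fun _ _ => none, 0, fun _ l => isEmptyElim l, fun k => isEmptyElim k⟩
  rcases isEmpty_or_nonempty (Fin N) with hN | ⟨⟨n₀⟩⟩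
  · exact ⟨m, fun _ _ => none, 0, fun n => isEmptyElim n, fun k _ => ⟨rfl, fun n => isEmptyElim n⟩⟩
  obtain ⟨φ, hφ⟩ := exists_fin_range_superset (s := (A : Set (Fin K))) A.finite_toSet (p := β)
    (by simpa using h.card_le)
  have hval (k : Fin K) : ∃ w : Fin (v - 1) → F,
      k ∈ A → ∀ n, x n k ≠ x n₀ k → ∃ j, w j = x n k := by
    by_cases hk : k ∈ A
    · have hfin := Set.finite_range fun n => x n k
      obtain ⟨w, hw⟩ := exists_fin_range_superset
        (s := (Set.range fun n => x n k) \ {x n₀ k}) hfin.sdiff (p := v - 1) (by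
          rw [Set.ncard_sdiff_singleton_of_mem (Set.mem_range_self n₀)]
          exact Nat.sub_le_sub_right (h.versions k hk) 1)
      exact ⟨w, fun _ n hn => hw ⟨⟨n, rfl⟩, hn⟩⟩
    · exact ⟨0, fun h => absurd h hk⟩
  choose w hw using hval
  let e : Fin K → F := fun k => if k ∈ A then x n₀ k else m k
  let a : Fin β × Fin (v - 1) → F := fun p => w (φ p.1) p.2 - e (φ p.1)
  have hP (n : Fin N) (l : Fin K) : ∃ o : Option (Fin β × Fin (v - 1)),
      x n l = e l + o.elim 0 a ∧ (l ∉ A → o = none) := by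
    by_cases hl : l ∈ A
    · by_cases hx : x n l = x n₀ l
      · exact ⟨none, by simp [e, hl, hx], fun _ => rfl⟩
      · obtain ⟨i, hi⟩ := hφ hl
        obtain ⟨j, hj⟩ := hw l hl n hx
        exact ⟨some (i, j), by simp [a, hi, hj], fun h => absurd hl h⟩
    · exact ⟨none, by simp [e, hl, h.honest l hl], fun _ => rfl⟩
  choose P hP using hP
  exact ⟨e, P, a, fun n l => (hP n l).1, fun k hk => ⟨if_neg hk, fun n => (hP n k).2 hk⟩⟩

theorem isLinearMap_sum_mul {F : Type*} [Field F] {K : ℕ} (c : Fin K → F) :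
    IsLinearMap F fun x : Fin K → F => ∑ l, c l * x l :=
  ⟨fun x y => by simp [mul_add, Finset.sum_add_distrib],
    fun r x => by simp [Finset.mul_sum, mul_left_comm]⟩

theorem Code.isMDS_of_injective {F : Type*} [Nonempty F] {N K t : ℕ} (C : Code F N K t)
    (h : ∀ S : Finset (Fin N), S.card = K →
      Function.Injective fun (m : Fin K → F) (n : S) => C.enc n m) : C.IsMDS :=
  fun S hS => ⟨_, Function.leftInverse_invFun (h S hS)⟩

theorem HasTrivialKernels.injective {F : Type*} [Field F] {N K : ℕ} {C : Fin N → Fin K → F}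
    (hC : HasTrivialKernels C) {S : Finset (Fin N)} (hS : S.card = K) :
    Function.Injective fun (m : Fin K → F) (n : S) => ∑ l, C n l * m l := by
  intro m m' h
  refine sub_eq_zero.mp (hC S hS (m - m') fun n hn => ?_)
  simpa [mul_sub, sub_eq_zero] using congrFun h ⟨n, hn⟩

/-- The decoder that outputs, for each source, a message consistent with what was read. -/
noncomputable def consistentDecoder {F : Type*} [Zero F] {N K : ℕ} (enc : Fin N → (Fin K → F) → F)
    (β v : ℕ) (T : Finset (Fin N)) (y : T → F) (k : Fin K) : F :=
  open Classical in
  if h : ∃ (c : F) (A : Finset (Fin K)) (m : Fin K → F) (x : Fin N → Fin K → F),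
    IsBehaviour β v A m x ∧ k ∉ A ∧ (fun n : T => enc n (x n)) = y ∧ m k = c
  then h.choose else 0

theorem mem_linearCorrectSet_of_separatesErrors {F : Type*} [Field F] {N K β v : ℕ}
    {C : Fin N → Fin K → F} (hC : HasTrivialKernels C)
    (hC' : SeparatesErrors (Fin β × Fin (v - 1)) C) :
    K + 2 * β * (v - 1) ∈ linearCorrectSet F N K β v := by
  refine ⟨⟨fun n x => ∑ l, C n l * x l,
    fun T _ y => consistentDecoder (fun n x => ∑ l, C n l * x l) β v T y⟩,
    fun n => isLinearMap_sum_mul (C n), fun T hT A m x hx k hk => ?_,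
    Code.isMDS_of_injective _ fun S hS => hC.injective hS⟩
  have hex : ∃ (c : F) (A' : Finset (Fin K)) (m' : Fin K → F) (x' : Fin N → Fin K → F),
      IsBehaviour β v A' m' x' ∧ k ∉ A' ∧
        (fun n : T => ∑ l, C n l * x' n l) = (fun n : T => ∑ l, C n l * x n l) ∧ m' k = c :=
    ⟨m k, A, m, x, hx, hk, rfl, rfl⟩
  dsimp only
  rw [consistentDecoder, dif_pos hex]
  obtain ⟨A', m', x', hx', hk', hy, hm'⟩ := hex.choose_spec
  rw [← hm']
  obtain ⟨e, P, a, hxe, he⟩ := hx.exists_patternError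
  obtain ⟨e', P', a', hxe', he'⟩ := hx'.exists_patternError
  -- Both behaviours explain the same readings, so their difference is annihilated on `T`.
  have hkey := hC' T (by rw [hT]; simp [mul_assoc]) P' P (e' - e) a' a k (he' k hk').2 (he k hk).2
    fun n hn => by
      have := congrFun hy ⟨n, hn⟩
      rw [← sub_eq_zero, ← Finset.sum_sub_distrib] at this
      rw [← this]
      refine Finset.sum_congr rfl fun l _ => ?_
      simp only [hxe, hxe', Pi.sub_apply]
      ring
  rw [← (he k hk).1, ← (he' k hk').1]
  exact sub_eq_zero.mp hkey

/-- With a systematic code, every source's message can be read off its own node. -/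
theorem mem_linearCorrectSet_of_trivialKernels {F : Type*} [Field F] {N K : ℕ} (β v : ℕ)
    (hKN : K ≤ N) {C : Fin N → Fin K → F} (hC : HasTrivialKernels C) :
    N ∈ linearCorrectSet F N K β v := by
  classical
  let G : (Fin K → F) →ₗ[F] (Fin N → F) := Matrix.mulVecLin (Matrix.of C)
  let top : (Fin K → F) →ₗ[F] (Fin K → F) := (LinearMap.funLeft F F (Fin.castLE hKN)).comp G
  have htop : Function.Injective top := by
    rw [injective_iff_map_eq_zero]
    intro m hm
    refine hC (Finset.univ.map (Fin.castLEEmb hKN)) (by simp) m fun n hn => ?_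
    obtain ⟨k, -, rfl⟩ := Finset.mem_map.mp hn
    exact congrFun hm k
  -- Precomposing with `L.symm` makes the first `K` rows the identity.
  let L := LinearEquiv.ofInjectiveEndo top htop
  have hL (m : Fin K → F) (k : Fin K) : G (L.symm m) (Fin.castLE hKN k) = m k :=
    congrFun (L.apply_symm_apply m) k
  have huniv {T : Finset (Fin N)} (hT : T.card = N) (n : Fin N) : n ∈ T := by
    rw [(Finset.card_eq_iff_eq_univ T).mp (by simpa using hT)]
    exact Finset.mem_univ n
  refine ⟨⟨fun n x => G (L.symm x) n, fun T hT y k => y ⟨Fin.castLE hKN k, huniv hT _⟩⟩,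
    fun n => ⟨fun x y => by simp, fun r x => by simp⟩, fun T hT A m x hx k hk => ?_,
    Code.isMDS_of_injective _ fun S hS =>
      (hC.injective hS).comp (g := fun (m : Fin K → F) (n : S) => ∑ l, C n l * m l)
        L.symm.injective⟩
  exact (hL _ k).trans (hx.honest k hk _)

/-! ### Converse -/

theorem isLinearMap_apply_eq_sum {F : Type*} [Field F] {K : ℕ} {f : (Fin K → F) → F}
    (hf : IsLinearMap F f) (x : Fin K → F) : f x = ∑ l, f (Pi.single l 1) * x l := by
  have := (hf.mk' f).pi_apply_eq_sum_univ x
  simp only [IsLinearMap.mk'_apply, smul_eq_mul] at this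
  rw [this]
  refine Finset.sum_congr rfl fun l _ => ?_
  rw [mul_comm]
  congr 2
  funext i
  simp [Pi.single_apply, eq_comm]

/-- Greedy choice: at least `K` nodes of `U` are always unused, and no column vanishes on `K` nodes.
-/
theorem HasTrivialKernels.exists_slot_assignment {F σ : Type*} [Field F] {N K : ℕ}
    {C : Fin N → Fin K → F} (hC : HasTrivialKernels C) (κ : σ → Fin K) (s : Finset σ)
    {U : Finset (Fin N)} (hU : K + s.card ≤ U.card) :
    ∃ f : σ → Fin N, Set.InjOn f s ∧ ∀ i ∈ s, f i ∈ U ∧ C (f i) (κ i) ≠ 0 := by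
  classical
  induction s using Finset.induction_on with
  | empty =>
    rcases isEmpty_or_nonempty σ with h | ⟨⟨i⟩⟩
    · exact ⟨fun i => isEmptyElim i, by simp, by simp⟩
    · have : 0 < U.card := by have := (κ i).pos; omega
      obtain ⟨n, -⟩ := Finset.card_pos.mp this
      exact ⟨fun _ => n, by simp, by simp⟩
  | insert i s hi ih =>
    rw [Finset.card_insert_of_notMem hi] at hU
    obtain ⟨f, hf, hfU⟩ := ih (by omega)
    have hcard : K ≤ (U \ s.image f).card := by
      have := Finset.le_card_sdiff (s.image f) U
      have := Finset.card_image_le (s := s) (f := f)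
      omega
    obtain ⟨S, hSU, hS⟩ := Finset.exists_subset_card_eq hcard
    obtain ⟨n, hn, hne⟩ : ∃ n ∈ S, C n (κ i) ≠ 0 := by
      by_contra! h
      have := congrFun (hC S hS (Pi.single (κ i) 1) fun n hn => by
        simp [Pi.single_apply, h n hn]) (κ i)
      simp at this
    obtain ⟨hnU, hnf⟩ := Finset.mem_sdiff.mp (hSU hn)
    have hupd : ∀ j ∈ s, Function.update f i n j = f j := fun j hj =>
      Function.update_of_ne (ne_of_mem_of_not_mem hj hi) _ _
    refine ⟨Function.update f i n, ?_, ?_⟩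
    · rw [Finset.coe_insert, Set.injOn_insert (by simpa using hi)]
      refine ⟨fun x hx y hy h => hf hx hy (by rwa [hupd x hx, hupd y hy] at h), ?_⟩
      rintro ⟨j, hj, h⟩
      rw [hupd j hj, Function.update_self] at h
      exact hnf (Finset.mem_image.mpr ⟨j, hj, h⟩)
    · intro j hj
      rcases Finset.mem_insert.mp hj with rfl | hj
      · simpa using ⟨hnU, hne⟩
      · rw [hupd j hj]
        exact hfU j hj

/-- The encoding on `S` is invertible, and row `k` of its inverse has a nonzero entry, at `n₀` say;
`d` is the corresponding column. -/
theorem HasTrivialKernels.exists_vanishing_erase {F : Type*} [Field F] {N K : ℕ}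
    {C : Fin N → Fin K → F} (hC : HasTrivialKernels C) {S : Finset (Fin N)} (hS : S.card = K)
    (k : Fin K) :
    ∃ n₀ ∈ S, ∃ d : Fin K → F, d k ≠ 0 ∧ ∀ n ∈ S, n ≠ n₀ → ∑ l, C n l * d l = 0 := by
  classical
  let G : (Fin K → F) →ₗ[F] (S → F) := Matrix.mulVecLin (Matrix.of fun n : S => C n)
  let L := LinearEquiv.ofInjectiveOfFinrankEq G (hC.injective hS) (by simp [hS])
  have hL (y : S → F) (n : S) : ∑ l, C n l * L.symm y l = y n := congrFun (L.apply_symm_apply y) n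
  by_contra! h
  have hzero : (LinearMap.proj k).comp L.symm.toLinearMap = (0 : (S → F) →ₗ[F] F) := by
    refine LinearMap.pi_ext fun n c => ?_
    by_contra hne
    obtain ⟨n', hn', hne', h'⟩ := h n n.2 (L.symm (Pi.single n c)) hne
    refine h' ?_
    rw [hL _ ⟨n', hn'⟩]
    have : (⟨n', hn'⟩ : S) ≠ n := fun h => hne' (congrArg Subtype.val h)
    simp [this]
  have := LinearMap.congr_fun hzero (L (Pi.single k 1))
  simp at this

/-- The error that puts the value `c i` into the column `κ i` of the row `f i`, for `i ∈ s`. -/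
def slotError {F σ : Type*} [AddCommMonoid F] {N K : ℕ} (s : Finset σ) (f : σ → Fin N)
    (κ : σ → Fin K) (c : σ → F) (n : Fin N) (l : Fin K) : F :=
  ∑ i ∈ s with f i = n ∧ κ i = l, c i

/-- Slots occupy distinct rows, so at most one term contributes to each entry. -/
theorem slotError_mem {F σ : Type*} [AddCommMonoid F] {N K : ℕ} {s : Finset σ} {f : σ → Fin N}
    (hf : Set.InjOn f s) (κ : σ → Fin K) (c : σ → F) (n : Fin N) (l : Fin K) :
    slotError s f κ c n l = 0 ∨ ∃ i ∈ s, κ i = l ∧ slotError s f κ c n l = c i := by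
  classical
  unfold slotError
  rcases Finset.eq_empty_or_nonempty {i ∈ s | f i = n ∧ κ i = l} with h | ⟨i, hi⟩
  · exact Or.inl (by rw [h, Finset.sum_empty])
  · rw [Finset.mem_filter] at hi
    refine Or.inr ⟨i, hi.1, hi.2.2, Finset.sum_eq_single_of_mem i (by simpa using hi) ?_⟩
    intro j hj hji
    rw [Finset.mem_filter] at hj
    exact absurd (hf hj.1 hi.1 (hj.2.1.trans hi.2.1.symm)) hji

theorem sum_mul_slotError {F σ : Type*} [Field F] {N K : ℕ} (C : Fin N → Fin K → F) (s : Finset σ)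
    (f : σ → Fin N) (κ : σ → Fin K) (c : σ → F) (n : Fin N) :
    ∑ l, C n l * slotError s f κ c n l = ∑ i ∈ s with f i = n, C n (κ i) * c i := by
  classical
  simp only [slotError, Finset.mul_sum, Finset.sum_filter, ite_and]
  rw [Finset.sum_comm]
  refine Finset.sum_congr rfl fun i _ => ?_
  by_cases h : f i = n <;> simp [h]

/-- Adding to the messages an error with at most `v - 1` slots for each of the first `β` sources
is a possible behaviour of the sources. -/
theorem isBehaviour_add_slotError {F : Type*} [Field F] {N K β v : ℕ} (hβ : β ≤ K) (hv : 1 ≤ v)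
    {s : Finset (Fin β × Fin (v - 1))} {f : Fin β × Fin (v - 1) → Fin N} (hf : Set.InjOn f s)
    (c : Fin β × Fin (v - 1) → F) (m : Fin K → F) :
    IsBehaviour β v (Finset.univ.map (Fin.castLEEmb hβ)) m
      (fun n l => m l + slotError s f (fun i => Fin.castLE hβ i.1) c n l) where
  card_le := by simp
  honest k hk n := by
    rcases slotError_mem hf (fun i => Fin.castLE hβ i.1) c n k with h | ⟨i, -, hi, -⟩
    · simp [h]
    · exact absurd (Finset.mem_map.mpr ⟨i.1, Finset.mem_univ _, hi⟩) hk
  versions k hk := by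
    classical
    obtain ⟨b, -, rfl⟩ := Finset.mem_map.mp hk
    let vals : Finset F := insert (m (Fin.castLE hβ b))
      (Finset.univ.image fun j : Fin (v - 1) => m (Fin.castLE hβ b) + c (b, j))
    have hsub : (Set.range fun n => m (Fin.castLE hβ b) +
        slotError s f (fun i => Fin.castLE hβ i.1) c n (Fin.castLE hβ b)) ⊆ vals := by
      rintro _ ⟨n, rfl⟩
      dsimp only
      rcases slotError_mem hf (fun i => Fin.castLE hβ i.1) c n (Fin.castLE hβ b) with
        h | ⟨⟨b', j⟩, -, hi, h⟩
      · simp [vals, h]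
      · obtain rfl : b' = b := Fin.castLE_injective hβ hi
        rw [h]
        simp [vals]
    refine (Set.ncard_le_ncard hsub vals.finite_toSet).trans ?_
    rw [Set.ncard_coe_finset]
    refine (Finset.card_insert_le _ _).trans ?_
    have := Finset.card_image_le (s := (Finset.univ : Finset (Fin (v - 1))))
      (f := fun j => m (Fin.castLE hβ b) + c (b, j))
    rw [Finset.card_univ, Fintype.card_fin] at this
    omega

theorem Code.IsMDS.hasTrivialKernels {F : Type*} [Field F] {N K t : ℕ} {C : Code F N K t}
    (hC : C.IsMDS) (hlin : C.IsLinear) :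
    HasTrivialKernels fun n l => C.enc n (Pi.single l 1) := by
  intro T hT d hd
  obtain ⟨r, hr⟩ := hC T hT
  have h : (fun n : T => C.enc n d) = fun n : T => C.enc n 0 := by
    funext n
    rw [(hlin n).map_zero, isLinearMap_apply_eq_sum (hlin n), hd n n.2]
  rw [← hr d, h, hr 0]

theorem notMem_linearCorrectSet {F : Type*} [Field F] {N K β v t : ℕ} (hβ : β < K) (hv : 1 ≤ v)
    (hKN : K ≤ N) (htN : t < N) (ht : t < K + 2 * β * (v - 1)) :
    t ∉ linearCorrectSet F N K β v := by
  classical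
  rintro ⟨C, hlin, hrec, hmds⟩
  have hker := hmds.hasTrivialKernels hlin
  set c : Fin N → Fin K → F := fun n l => C.enc n (Pi.single l 1)
  have henc (n : Fin N) (x : Fin K → F) : C.enc n x = ∑ l, c n l * x l := isLinearMap_apply_eq_sum (hlin n) x
  let σ := Fin β × Fin (v - 1)
  let κ : σ → Fin K := fun i => Fin.castLE hβ.le i.1
  -- Left slots belong to one behaviour, right slots to the other. The subtraction truncates for `t
  -- < K`, so `U` below has `max K (t + 1)` nodes.
  obtain ⟨s, -, hs⟩ := Finset.exists_subset_card_eq (s := (Finset.univ : Finset (σ ⊕ σ)))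
    (n := t + 1 - K) (by
      rw [Finset.card_univ, Fintype.card_sum, Fintype.card_prod, Fintype.card_fin, Fintype.card_fin]
      rw [mul_assoc] at ht
      omega)
  obtain ⟨U, -, hU⟩ := Finset.exists_subset_card_eq (s := (Finset.univ : Finset (Fin N)))
    (n := K + (t + 1 - K)) (by rw [Finset.card_univ, Fintype.card_fin]; omega)
  obtain ⟨f, hf, hfU⟩ := hker.exists_slot_assignment (Sum.elim κ κ) s (U := U) (by rw [hs, hU])
  have hS : (U \ s.image f).card = K := by
    rw [Finset.card_sdiff_of_subset (Finset.image_subset_iff.mpr fun i hi => (hfU i hi).1),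
      Finset.card_image_of_injOn hf, hs, hU]
    omega
  obtain ⟨n₀, hn₀, d, hdk, hd⟩ := hker.exists_vanishing_erase hS ⟨β, hβ⟩
  -- Outside the slot nodes, `n₀` is the only node of `U` where `d` may be visible.
  obtain ⟨T, hTU, hT⟩ := Finset.exists_subset_card_eq (s := U.erase n₀) (n := t) (by
    rw [Finset.card_erase_of_mem (Finset.mem_sdiff.mp hn₀).1, hU]
    omega)
  -- The change of entry at slot `i` that accounts for all of `d` at node `f i`: subtracted from `d`
  -- on the left, added to `0` on the right.
  let b : σ ⊕ σ → F := fun i => (∑ l, c (f i) l * d l) / c (f i) (Sum.elim κ κ i)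
  have hfl : Set.InjOn (fun i => f (Sum.inl i)) s.toLeft := fun i hi j hj h =>
    Sum.inl_injective (hf (by simpa using hi) (by simpa using hj) h)
  have hfr : Set.InjOn (fun i => f (Sum.inr i)) s.toRight := fun i hi j hj h =>
    Sum.inr_injective (hf (by simpa using hi) (by simpa using hj) h)
  have hx := isBehaviour_add_slotError hβ.le hv hfl (fun i => -b (Sum.inl i)) d
  have hx' := isBehaviour_add_slotError hβ.le hv hfr (fun i => b (Sum.inr i)) 0
  have hb (i) (hi : i ∈ s) : c (f i) (Sum.elim κ κ i) * b i = ∑ l, c (f i) l * d l :=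
    mul_div_cancel₀ _ (hfU i hi).2
  have hagree (n : Fin N) (hn : n ∈ T) :
      ∑ l, c n l * (d l + slotError s.toLeft (fun i => f (Sum.inl i)) κ
          (fun i => -b (Sum.inl i)) n l) =
        ∑ l, c n l * ((0 : Fin K → F) l + slotError s.toRight (fun i => f (Sum.inr i)) κ
          (fun i => b (Sum.inr i)) n l) := by
    simp only [mul_add, Finset.sum_add_distrib, sum_mul_slotError, Pi.zero_apply,
      zero_add]
    have hsum : ∑ l, c n l * d l = ∑ i ∈ s with f i = n, c n (Sum.elim κ κ i) * b i := by
      by_cases h : n ∈ s.image f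
      · obtain ⟨i, hi, rfl⟩ := Finset.mem_image.mp h
        rw [Finset.sum_eq_single_of_mem i (by simpa using hi), hb i hi]
        intro j hj hji
        rw [Finset.mem_filter] at hj
        exact absurd (hf hj.1 hi hj.2) hji
      · obtain ⟨hne, hnU⟩ := Finset.mem_erase.mp (hTU hn)
        rw [hd n (Finset.mem_sdiff.mpr ⟨hnU, h⟩) hne, Finset.filter_false_of_mem, Finset.sum_empty]
        exact fun i hi hin => h (Finset.mem_image.mpr ⟨i, hi, hin⟩)
    rw [hsum, Finset.sum_filter, Finset.sum_filter, Finset.sum_filter, ← s.toLeft_disjSum_toRight,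
      Finset.sum_disjSum]
    simp only [Sum.elim_inl, Sum.elim_inr, Finset.toLeft_disjSum, Finset.toRight_disjSum]
    rw [add_right_comm, ← Finset.sum_add_distrib, Finset.sum_eq_zero, zero_add]
    intro i _
    split_ifs <;> ring
  have hk : (⟨β, hβ⟩ : Fin K) ∉ Finset.univ.map (Fin.castLEEmb hβ.le) := by
    intro h
    obtain ⟨i, -, hi⟩ := Finset.mem_map.mp h
    exact i.isLt.ne (congrArg Fin.val hi)
  have h1 := hrec T hT _ _ _ hx _ hk
  have h2 := hrec T hT _ _ _ hx' _ hk
  have hy : (fun n : T => C.enc n (fun l => d l + slotError s.toLeft (fun i => f (Sum.inl i)) κ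
          (fun i => -b (Sum.inl i)) n l)) =
      fun n : T => C.enc n (fun l => (0 : Fin K → F) l +
        slotError s.toRight (fun i => f (Sum.inr i)) κ (fun i => b (Sum.inr i)) n l) := by
    funext n
    rw [henc, henc]
    exact hagree n n.2
  exact hdk (h1.symm.trans ((congrFun (congrArg (C.dec T hT) hy) _).trans h2))

end DistEnc

theorem theorem1 (N K β v : ℕ) (hβ : β < K) (hv : 1 ≤ v) :
    ∃ q₀ : ℕ, ∀ (F : Type*) [Field F] [Finite F], q₀ ≤ Nat.card F →
      (K + 2 * β * (v - 1) ≤ N →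
        IsLeast (DistEnc.linearCorrectSet F N K β v) (K + 2 * β * (v - 1))) ∧
      (K ≤ N → N < K + 2 * β * (v - 1) →
        IsLeast (DistEnc.linearCorrectSet F N K β v) N) := by
  obtain ⟨q₀, hq₀⟩ := DistEnc.exists_trivialKernels_separatesErrors N K (Fin β × Fin (v - 1))
  refine ⟨q₀, fun F _ _ hF => ?_⟩
  obtain ⟨C, hC, hC'⟩ := hq₀ F hF
  refine ⟨fun hN => ⟨DistEnc.mem_linearCorrectSet_of_separatesErrors hC hC', fun t ht => ?_⟩,
    fun hKN hN => ⟨DistEnc.mem_linearCorrectSet_of_trivialKernels β v hKN hC, fun t ht => ?_⟩⟩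
  · by_contra! hlt
    exact DistEnc.notMem_linearCorrectSet hβ hv ((Nat.le_add_right _ _).trans hN)
      (hlt.trans_le hN) hlt ht
  · by_contra! hlt
    exact DistEnc.notMem_linearCorrectSet hβ hv hKN hlt (hlt.trans hN) ht
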